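/- Let $d\ge 3$ and let $G$ be a forest (a finite simple graph without cycles) on the vertex set $[n]=\{1,\dots,n\}$. Let $L_G(d)\subset\mathbb{C}[x_{i,k} : i\in[n],\, 1\le k\le d]$ be the ideal generated by the polynomials $\sum_{k=1}^d x_{i,k}x_{j,k}$ for $\{i,j\}\in E(G)$, and let $\mathrm{OR}_d(\overline{G})\subset(\mathbb{C}^d)^n$ be its zero set, i.e. the set of tuples $(v_1,\dots,v_n)$ of vectors of $\mathbb{C}^d$ with $v_i\cdot v_j=\sum_{k} v_{i,k}v_{j,k}=0$ for every edge $\{i,j\}$ of $G$. For $S\subseteq[n]$ let $$U(S)=\{(v_1,\dots,v_n)\in \mathrm{OR}_d(\overline{G}) : v_i=0 \text{ if and only if } i\in S\},$$ and let $V_S$ be the Zariski closure of $U(S)$ in $\mathbb{C}^{dn}$. Write $N_G(i)$ for the set of neighbours of $i$ in $G$. Call $S$ $G$-admissible if for every $i\in S$ one has $|N_G(i)\cap([n]\setminus S)|\ge d$ and $N_G(i)\cap([n]\setminus S)\not\subseteq N_G(j)\cap([n]\setminus S)$ for every $j\in[n]\setminus S$. Then for every $G$-admissible $S\subseteq[n]$,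 $$\dim V_S = d\,(n-|S|)-|E(G_{[n]\setminus S})|,$$ where $G_{[n]\setminus S}$ is the subgraph of $G$ induced on $[n]\setminus S$, and $\dim$ is the dimension of an affine variety, i.e. the Krull dimension of its coordinate ring. -/

import Mathlib

namespace LSS

/-- Points of `(ℂ^d)^n`, the tuples `v = (v_1, …, v_n)`; the `k`-th coordinate of `v_i` is
`v (i, k)`. -/
abbrev Pt (n d : ℕ) : Type := Fin n × Fin d → ℂ

/-- The polynomial ring `ℂ[X]` in the entries of an `n × d` matrix of indeterminates. -/
abbrev Poly (n d : ℕ) : Type := MvPolynomial (Fin n × Fin d) ℂ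

/-- The polynomial `∑ k, x_{i,k} x_{j,k}`. -/
noncomputable def edgePoly {n : ℕ} (d : ℕ) (i j : Fin n) : Poly n d :=
  ∑ k : Fin d, MvPolynomial.X (i, k) * MvPolynomial.X (j, k)

/-- The Lovász–Saks–Schrijver ideal `L_G(d)`, generated by the edge polynomials. -/
noncomputable def lssIdeal {n : ℕ} (d : ℕ) (G : SimpleGraph (Fin n)) : Ideal (Poly n d) :=
  Ideal.span {f | ∃ i j : Fin n, G.Adj i j ∧ f = edgePoly d i j}

/-- The variety of orthogonal representations in dimension `d` of the complement of `G`: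
the zero set of `L_G(d)`. -/
def orVariety {n : ℕ} (d : ℕ) (G : SimpleGraph (Fin n)) : Set (Pt n d) :=
  MvPolynomial.zeroLocus ℂ (lssIdeal d G)

/-- The set `U(S)` of the points of the variety whose `i`-th vector is zero exactly
when `i ∈ S`. -/
def strataU {n : ℕ} (d : ℕ) (G : SimpleGraph (Fin n)) (S : Finset (Fin n)) : Set (Pt n d) :=
  {v | v ∈ orVariety d G ∧ ∀ i : Fin n, (∀ k : Fin d, v (i, k) = 0) ↔ i ∈ S}

/-- The Zariski closure of a subset of affine space: the common zeros of all polynomials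
that vanish on it. -/
def zariskiClosure {σ : Type} (A : Set (σ → ℂ)) : Set (σ → ℂ) :=
  MvPolynomial.zeroLocus ℂ (MvPolynomial.vanishingIdeal ℂ A)

/-- `V_S`, the Zariski closure of `U(S)`. -/
def varietyV {n : ℕ} (d : ℕ) (G : SimpleGraph (Fin n)) (S : Finset (Fin n)) : Set (Pt n d) :=
  zariskiClosure (strataU d G S)

/-- The dimension of a Zariski closed subset of affine space: the Krull dimension of its
coordinate ring `ℂ[X] / I(V)`. -/
noncomputable def algDim {σ : Type} (V : Set (σ → ℂ)) : WithBot ℕ∞ :=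
  ringKrullDim (MvPolynomial σ ℂ ⧸ MvPolynomial.vanishingIdeal ℂ V)

/-- `N_G(i) ∩ ([n] ∖ S)`. -/
def outerNbhd {n : ℕ} (G : SimpleGraph (Fin n)) (S : Finset (Fin n)) (i : Fin n) :
    Set (Fin n) :=
  G.neighborSet i ∩ (S : Set (Fin n))ᶜ

/-- `S` is `G`-admissible (in dimension `d`): every `i ∈ S` has at least `d` neighbours outside
`S`, and these are not all neighbours of a single vertex `j ∉ S`. -/
def Admissible {n : ℕ} (d : ℕ) (G : SimpleGraph (Fin n)) (S : Finset (Fin n)) : Prop :=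
  ∀ i ∈ S, d ≤ (outerNbhd G S i).ncard ∧
    ∀ j : Fin n, j ∉ S → ¬ outerNbhd G S i ⊆ outerNbhd G S j

/-- The number of edges of the subgraph of `G` induced on `[n] ∖ S`. -/
noncomputable def outerEdges {n : ℕ} (G : SimpleGraph (Fin n)) (S : Finset (Fin n)) : ℕ :=
  (G.induce (S : Set (Fin n))ᶜ).edgeSet.ncard

end LSS

/-!
Let `H` be the forest induced by `G` on the complement of `S`, with a root chosen in each component.
A point of `U(S)` is an orthogonal representation of `H` by nonzero vectors, extended by zero.

Over a field, if `v_p ≠ 0` then the vectors orthogonal to `v_p` are exactly the vectors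
`(M - Mᵀ) v_p` for square matrices `M`. Choosing a matrix at every vertex therefore gives a
polynomial map from an affine space to the orthogonal representations of `H`. It hits every point of
`U(S)`, and a generic matrix tuple is sent into `U(S)`. Hence the vanishing ideal of `U(S)` is the
kernel of the dual homomorphism to a polynomial ring (`LSS.vanishingIdeal_strataU`), and the
coordinate ring of `V_S` is the domain generated by the coordinates of the generic representation.

By Noether normalization its Krull dimension is its transcendence degree
(`exists_ringKrullDim_eq_and_trdeg_eq`), which is the number of pairs `(i, k)` such that `i` is a root
or `k ≠ c`, for a fixed coordinate `c` (`RootedForest.trdeg_adjoin_genericRep`). It is at most that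
number because `v_i ⬝ v_p = 0` makes the coordinate `c` of a non-root vertex algebraic over the
others. It is at least that number because, when all matrices are supported in the column `c`, the
coordinates of the representation generate the field of rational functions in the remaining matrix
entries. Every edge of `H` joins a unique non-root vertex to its parent, so the number is
`d (n - |S|) - |E(H)|`.
-/

open MvPolynomial

/-! ### Krull dimension and transcendence degree -/

/-- Lying over and going up lift chains of primes from `R` to `A`, and incomparability makes
contraction of primes strictly monotone. -/
theorem ringKrullDim_eq_of_isIntegral_of_injective {R A : Type*} [CommRing R] [CommRing A]
    [Algebra R A] [Algebra.IsIntegral R A] (h : Function.Injective (algebraMap R A)) :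
    ringKrullDim A = ringKrullDim R := by
  apply le_antisymm
  · refine Order.krullDim_le_of_strictMono (PrimeSpectrum.comap (algebraMap R A)) ?_
    intro I J hIJ
    exact Ideal.IsIntegral.comap_lt_comap (I := I.asIdeal) (J := J.asIdeal) hIJ
  · refine iSup_le fun l ↦ ?_
    obtain ⟨Q, -, hQ, hQl⟩ := Ideal.exists_ideal_over_prime_of_isIntegral
      l.head.asIdeal (⊥ : Ideal A) (by
        rw [← RingHom.ker_eq_comap_bot, (RingHom.injective_iff_ker_eq_bot _).1 h]
        exact bot_le)
    have : Q.LiesOver l.head.asIdeal := ⟨hQl.symm⟩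
    obtain ⟨L, hL, -⟩ := Ideal.exists_ltSeries_of_hasGoingUp l Q
    rw [← hL]
    exact Order.LTSeries.length_le_krullDim L

/-- For a domain of finite type over a field, Krull dimension and transcendence degree agree and are
finite: both are the number of variables in a Noether normalization. -/
theorem exists_ringKrullDim_eq_and_trdeg_eq (k A : Type*) [Field k] [CommRing A] [IsDomain A]
    [Algebra k A] [Algebra.FiniteType k A] :
    ∃ s : ℕ, ringKrullDim A = s ∧ Algebra.trdeg k A = s := by
  obtain ⟨s, g, hg, hi⟩ := exists_integral_inj_algHom_of_fg k A
  refine ⟨s, ?_, ?_⟩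
  · algebraize [g.toRingHom]
    have : Algebra.IsIntegral (MvPolynomial (Fin s) k) A := ⟨hi⟩
    rw [ringKrullDim_eq_of_isIntegral_of_injective (R := MvPolynomial (Fin s) k) hg,
      MvPolynomial.ringKrullDim_of_isNoetherianRing, ringKrullDim_eq_zero_of_field]
    simp
  · algebraize [g.toRingHom]
    have : Algebra.IsIntegral (MvPolynomial (Fin s) k) A := ⟨hi⟩
    have : FaithfulSMul (MvPolynomial (Fin s) k) A :=
      (faithfulSMul_iff_algebraMap_injective _ _).2 hg
    have : IsScalarTower k (MvPolynomial (Fin s) k) A :=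
      .of_algebraMap_eq fun x ↦ (g.commutes x).symm
    have h := lift_trdeg_add_eq k (MvPolynomial (Fin s) k) A
    rw [MvPolynomial.trdeg_of_isDomain, trdeg_eq_zero (R := MvPolynomial (Fin s) k)] at h
    simpa using h.symm

/-! ### Rooted forests -/

/-- A rooted forest on `V`, encoded by the partial function sending a vertex to its parent;
`none` marks the roots, and the rank makes recursion towards the roots well founded. -/
structure RootedForest (V : Type*) where
  parent : V → Option V
  rank : V → ℕ
  rank_lt : ∀ {i p}, parent i = some p → rank p < rank i

/-- Choose a root in each component and let the rank be the distance to it. The distances of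
adjacent vertices differ, and by uniqueness of paths a vertex has at most one neighbour closer to the
root. -/
theorem SimpleGraph.IsAcyclic.exists_rootedForest {V : Type*} {G : SimpleGraph V}
    (hG : G.IsAcyclic) : ∃ F : RootedForest V,
      ∀ i j, G.Adj i j ↔ F.parent i = some j ∨ F.parent j = some i := by
  classical
  let root : V → V := fun v ↦ (G.connectedComponentMk v).nonempty_supp.some
  have hreach (v : V) : G.Reachable (root v) v :=
    SimpleGraph.ConnectedComponent.exact (G.connectedComponentMk v).nonempty_supp.some_mem
  have hroot {v w : V} (h : G.Adj v w) : root v = root w := by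
    have h' : G.connectedComponentMk v = G.connectedComponentMk w :=
      SimpleGraph.ConnectedComponent.sound h.reachable
    simp only [root, h']
  let rank : V → ℕ := fun v ↦ G.dist (root v) v
  have huniq {v w w' : V} (h : G.Adj v w) (h' : G.Adj v w') (hr : rank w < rank v)
      (hr' : rank w' < rank v) : w = w' := by
    obtain ⟨p, hp, hpl⟩ := (hreach v).exists_path_of_dist
    have key (x : V) (hx : G.Adj v x) (hxr : rank x < rank v) : x = p.penultimate := by
      refine hG.eq_penultimate_of_adj_end hp hx ?_
      by_contra hmem
      obtain ⟨q, hq, hql⟩ := (hroot hx ▸ hreach x : G.Reachable (root v) x).exists_path_of_dist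
      have hv : v ∈ q.support := by
        by_contra hv
        exact hmem (hG.mem_support_of_ne_mem_support_of_adj_of_isPath hp hq hx hv)
      have := congrArg SimpleGraph.Walk.length (hG.path_concat hp hq hx hv)
      rw [SimpleGraph.Walk.length_concat, hpl, hql] at this
      simp only [rank, ← hroot hx] at hxr
      omega
    rw [key w h hr, key w' h' hr']
  let P (v w : V) : Prop := G.Adj v w ∧ rank w < rank v
  let par : V → Option V := fun v ↦ if h : ∃ w, P v w then some h.choose else none
  have hpar {v w : V} : par v = some w ↔ P v w := by
    by_cases h : ∃ w, P v w
    · simp only [par, h, dite_true, Option.some.injEq]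
      refine ⟨fun e ↦ e ▸ h.choose_spec, fun hw ↦ ?_⟩
      exact huniq h.choose_spec.1 hw.1 h.choose_spec.2 hw.2
    · simp only [par, h, dite_false]
      exact ⟨fun e ↦ by simp at e, fun hw ↦ (h ⟨w, hw⟩).elim⟩
  refine ⟨⟨par, rank, fun h ↦ (hpar.1 h).2⟩, fun i j ↦ ⟨fun h ↦ ?_, ?_⟩⟩
  · have := hG.dist_ne_of_adj h (hreach i)
    rcases lt_or_gt_of_ne this with hlt | hlt
    · exact .inr (hpar.2 ⟨h.symm, by simpa only [rank, ← hroot h] using hlt⟩)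
    · exact .inl (hpar.2 ⟨h, by simpa only [rank, ← hroot h] using hlt⟩)
  · rintro (h | h)
    · exact (hpar.1 h).1
    · exact (hpar.1 h).1.symm

/-- Each edge joins exactly one non-root vertex to its parent. -/
theorem RootedForest.ncard_edgeSet {V : Type*} (F : RootedForest V)
    {G : SimpleGraph V} (hF : ∀ i j, G.Adj i j ↔ F.parent i = some j ∨ F.parent j = some i) :
    G.edgeSet.ncard = Nat.card {i // F.parent i ≠ none} := by
  let f : {i // F.parent i ≠ none} → Sym2 V := fun i ↦
    s(i.1, (F.parent i.1).get (Option.isSome_iff_ne_none.2 i.2))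
  have hf : Function.Injective f := by
    rintro ⟨i, hi⟩ ⟨j, hj⟩ h
    obtain ⟨p, hp⟩ := Option.ne_none_iff_exists'.1 hi
    obtain ⟨q, hq⟩ := Option.ne_none_iff_exists'.1 hj
    simp only [f, hp, hq, Option.get_some, Sym2.eq_iff] at h
    rcases h with h | ⟨rfl, rfl⟩
    · exact Subtype.ext h.1
    · have := F.rank_lt hp
      have := F.rank_lt hq
      omega
  have hr : G.edgeSet = Set.range f := by
    ext e
    induction e with
    | h i j =>
      rw [SimpleGraph.mem_edgeSet, hF]
      constructor
      · rintro (h | h)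
        · exact ⟨⟨i, by simp [h]⟩, by simp [f, h]⟩
        · exact ⟨⟨j, by simp [h]⟩, by simp [f, h, Sym2.eq_swap]⟩
      · rintro ⟨⟨v, hv⟩, h⟩
        obtain ⟨p, hp⟩ := Option.ne_none_iff_exists'.1 hv
        simp only [f, hp, Option.get_some, Sym2.eq_iff] at h
        rcases h with ⟨rfl, rfl⟩ | ⟨rfl, rfl⟩
        · exact .inl hp
        · exact .inr hp
  rw [hr, ← Set.image_univ, Set.ncard_image_of_injective _ hf, Set.ncard_univ]

/-! ### Parametrizing orthogonal representations of a forest -/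

namespace RootedForest

variable {V : Type} {d : ℕ}

/-- The vectors `v_i` produced by a family of square matrices `a i`: at a root `v_i` is the column
`c` of `a i`, and at a vertex with parent `p` it is `(a i - (a i)ᵀ) v_p`, which is orthogonal
to `v_p` because `a i - (a i)ᵀ` is skew-symmetric. -/
def rep (F : RootedForest V) (c : Fin d) {R : Type} [CommRing R]
    (a : V → Fin d → Fin d → R) (i : V) : Fin d → R :=
  match _h : F.parent i with
  | none => fun k ↦ a i k c
  | some p => fun k ↦ ∑ l, (a i k l - a i l k) * F.rep c a p l
termination_by F.rank i
decreasing_by exact F.rank_lt ‹_›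

variable (F : RootedForest V) (c : Fin d) {R : Type} [CommRing R]

theorem rep_root {a : V → Fin d → Fin d → R} {i : V} (h : F.parent i = none) :
    F.rep c a i = fun k ↦ a i k c := by
  rw [rep]; split <;> simp_all

theorem rep_child {a : V → Fin d → Fin d → R} {i p : V} (h : F.parent i = some p) :
    F.rep c a i = fun k ↦ ∑ l, (a i k l - a i l k) * F.rep c a p l := by
  rw [rep]; split <;> simp_all

theorem induction_parent {P : V → Prop} (h : ∀ i, (∀ p, F.parent i = some p → P p) → P i)
    (i : V) : P i := by
  induction hn : F.rank i using Nat.strong_induction_on generalizing i with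
  | _ n ih => exact h i fun p hp ↦ ih _ (hn ▸ F.rank_lt hp) p rfl

theorem map_rep {R' : Type} [CommRing R'] (φ : R →+* R') (a : V → Fin d → Fin d → R) (i : V)
    (k : Fin d) : φ (F.rep c a i k) = F.rep c (fun i k l ↦ φ (a i k l)) i k := by
  induction i using F.induction_parent generalizing k with
  | h i ih =>
    cases hp : F.parent i with
    | none => simp only [F.rep_root c hp]
    | some p => simp [F.rep_child c hp, ih p hp]

theorem rep_orthogonal (a : V → Fin d → Fin d → R) {i p : V} (hp : F.parent i = some p) :
    ∑ k, F.rep c a i k * F.rep c a p k = 0 := by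
  simp only [F.rep_child c hp, sub_mul, Finset.sum_sub_distrib, Finset.sum_mul]
  rw [sub_eq_zero, Finset.sum_comm]
  exact Finset.sum_congr rfl fun l _ ↦ Finset.sum_congr rfl fun k _ ↦ by ring

/-- Every orthogonal representation by vectors with nonzero coordinate `e p` at each vertex `p`
is of the form `rep`. The matrix at a vertex with parent `p` is the rank one matrix `v_i bᵀ`, where
`b` is a multiple of a basis vector with `b ⬝ v_p = 1`. Its diagonal is irrelevant, as it cancels in
`a i - (a i)ᵀ`. -/
theorem rep_eq_of_orthogonal {K : Type} [Field K] (v : V → Fin d → K)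
    (horth : ∀ i p, F.parent i = some p → ∑ k, v i k * v p k = 0)
    (e : V → Fin d) (he : ∀ i, v i (e i) ≠ 0) (a : V → Fin d → Fin d → K)
    (hroot : ∀ i, F.parent i = none → ∀ k, a i k c = v i k)
    (hchild : ∀ i p, F.parent i = some p → ∀ k l, k ≠ l →
      a i k l = if l = e p then v i k / v p (e p) else 0) (i : V) :
    F.rep c a i = v i := by
  induction i using F.induction_parent with
  | h i ih =>
    cases hp : F.parent i with
    | none => rw [F.rep_root c hp]; exact funext (hroot i hp)
    | some p =>
      rw [F.rep_child c hp, ih p hp]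
      funext k
      have hcong : ∀ l, (a i k l - a i l k) * v p l =
          ((if l = e p then v i k / v p (e p) else 0) -
            (if k = e p then v i l / v p (e p) else 0)) * v p l := by
        intro l
        by_cases hkl : k = l
        · subst hkl; simp
        · rw [hchild i p hp k l hkl, hchild i p hp l k (Ne.symm hkl)]
      simp only [hcong, sub_mul, Finset.sum_sub_distrib, ite_mul, zero_mul,
        Finset.sum_ite_eq', Finset.mem_univ, if_true]
      rw [div_mul_cancel₀ _ (he p)]
      have : ∑ l, (if k = e p then v i l / v p (e p) * v p l else 0) = 0 := by
        split_ifs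
        · simp only [div_mul_eq_mul_div, ← Finset.sum_div, horth i p hp, zero_div]
        · simp
      rw [this, sub_zero]

/-- The coordinates of an orthogonal representation that can be chosen freely: all those of the
roots, and all but the coordinate `c` at the other vertices. -/
abbrev FreeCoord : Type := {x : V × Fin d // F.parent x.1 = none ∨ x.2 ≠ c}

theorem card_freeCoord_add [Finite V] :
    Nat.card (F.FreeCoord c) + Nat.card {i // F.parent i ≠ none} = d * Nat.card V := by
  classical
  have := Fintype.ofFinite V
  have e : {i // F.parent i ≠ none} ≃ {x : V × Fin d // ¬ (F.parent x.1 = none ∨ x.2 ≠ c)} :=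
    { toFun := fun i ↦ ⟨(i.1, c), by simpa using i.2⟩
      invFun := fun x ↦ ⟨x.1.1, (not_or.1 x.2).1⟩
      left_inv := fun _ ↦ rfl
      right_inv := fun x ↦ Subtype.ext (Prod.ext rfl (not_not.1 (not_or.1 x.2).2).symm) }
  rw [Nat.card_congr e, Nat.card_eq_fintype_card, Nat.card_eq_fintype_card,
    Fintype.card_subtype_compl, Nat.add_sub_cancel' (Fintype.card_subtype_le _)]
  simp [mul_comm]

/-- The free coordinates generate `A` up to algebraic elements: going down from the roots, the
relation `v_i ⬝ v_p = 0` expresses `v_{i,c} v_{p,c}` through coordinates already known to be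
algebraic. -/
theorem trdeg_le_card_freeCoord [Finite V] {k A : Type} [Field k] [CommRing A] [IsDomain A]
    [Algebra k A] (y : V → Fin d → A)
    (horth : ∀ i p, F.parent i = some p → ∑ k, y i k * y p k = 0)
    (hy : ∀ i, y i c ≠ 0)
    (htop : Algebra.adjoin k (Set.range fun x : V × Fin d ↦ y x.1 x.2) = ⊤) :
    Algebra.trdeg k A ≤ Nat.card (F.FreeCoord c) := by
  classical
  set s : Set A := Set.range fun x : F.FreeCoord c ↦ y x.1.1 x.1.2 with hs
  have hfree {i : V} {l : Fin d} (h : F.parent i = none ∨ l ≠ c) :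
      IsAlgebraic (Algebra.adjoin k s) (y i l) :=
    isAlgebraic_algebraMap
      (⟨y i l, Algebra.subset_adjoin ⟨⟨(i, l), h⟩, rfl⟩⟩ : Algebra.adjoin k s)
  have halg (i : V) (l : Fin d) : IsAlgebraic (Algebra.adjoin k s) (y i l) := by
    induction i using F.induction_parent generalizing l with
    | h i ih =>
      by_cases h : F.parent i = none ∨ l ≠ c
      · exact hfree h
      · obtain ⟨hne, hl⟩ := not_or.1 h
        obtain rfl := not_not.1 hl
        obtain ⟨p, hp⟩ := Option.ne_none_iff_exists'.1 hne
        refine IsAlgebraic.of_mul (mem_nonZeroDivisors_of_ne_zero (hy p)) (ih p hp l) ?_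
        have h0 := horth i p hp
        rw [← Finset.add_sum_erase _ _ (Finset.mem_univ l), mul_comm] at h0
        rw [eq_neg_of_add_eq_zero_left h0]
        refine (Subalgebra.algebraicClosure (Algebra.adjoin k s) A).neg_mem
          (Subalgebra.sum_mem _ fun m hm ↦ ?_)
        exact (hfree (.inr (Finset.ne_of_mem_erase hm))).mul (ih p hp m)
  have : Algebra.IsAlgebraic (Algebra.adjoin k s) A := by
    refine ⟨fun a ↦ IsAlgebraic.adjoin_of_forall_isAlgebraic
      (s := Set.range fun x : V × Fin d ↦ y x.1 x.2) ?_ ?_⟩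
    · rintro _ ⟨⟨x, rfl⟩, -⟩
      exact halg _ _
    · exact isAlgebraic_algebraMap (⟨a, htop ▸ Algebra.mem_top⟩ :
        Algebra.adjoin k (Set.range fun x : V × Fin d ↦ y x.1 x.2))
  refine (Algebra.IsAlgebraic.trdeg_le_cardinalMk k s).trans ?_
  rw [Nat.cast_card]
  exact Cardinal.mk_range_le

end RootedForest

/-- If every variable is a quotient of elements in the image of `g`, then the polynomial ring is
algebraic over that image, whose transcendence degree is at most that of `A`. -/
theorem MvPolynomial.card_le_trdeg_of_mul_X_mem_range {k A J : Type} [Field k] [CommRing A]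
    [Algebra k A] [Finite J] (g : A →ₐ[k] MvPolynomial J k)
    (h : ∀ j, ∃ a b, g a ≠ 0 ∧ g a * X j = g b) : (Nat.card J : Cardinal) ≤ Algebra.trdeg k A := by
  have hX (j : J) : IsAlgebraic g.range (X j : MvPolynomial J k) := by
    obtain ⟨a, b, ha, hab⟩ := h j
    refine IsAlgebraic.of_mul (mem_nonZeroDivisors_of_ne_zero ha)
      (isAlgebraic_algebraMap (⟨g a, a, rfl⟩ : g.range)) ?_
    rw [hab]
    exact isAlgebraic_algebraMap (⟨g b, b, rfl⟩ : g.range)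
  have : Algebra.IsAlgebraic g.range (MvPolynomial J k) := by
    refine ⟨fun p ↦ ?_⟩
    induction p using MvPolynomial.induction_on with
    | C r => exact isAlgebraic_algebraMap (algebraMap k g.range r)
    | add p q hp hq => exact hp.add hq
    | mul_X p j hp => exact hp.mul (hX j)
  have hadd := trdeg_add_eq k g.range (A := MvPolynomial J k)
  rw [MvPolynomial.trdeg_of_isDomain, trdeg_eq_zero (R := g.range), add_zero,
    Cardinal.lift_id] at hadd
  rw [Nat.cast_card, ← hadd]
  exact trdeg_le_of_surjective g.rangeRestrict g.rangeRestrict_surjective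

/-- A forest has an orthogonal representation all of whose vectors have a nonzero coordinate `c`:
use `e_c + e_{c'}` and `e_c - e_{c'}` on the two classes of a bipartition. -/
theorem SimpleGraph.IsAcyclic.exists_orthogonal {V : Type} {d : ℕ} {G : SimpleGraph V}
    (hG : G.IsAcyclic) {c c' : Fin d} (hc : c ≠ c') :
    ∃ v : V → Fin d → ℂ, (∀ i, v i c ≠ 0) ∧ ∀ i j, G.Adj i j → ∑ k, v i k * v j k = 0 := by
  let col := hG.coloringTwo
  let sgn : Fin 2 → ℂ := fun b ↦ if b = 0 then 1 else -1
  refine ⟨fun i k ↦ if k = c then 1 else if k = c' then sgn (col i) else 0, by simp, ?_⟩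
  intro i j hij
  have hs : sgn (col i) * sgn (col j) = -1 := by
    have hne : col i ≠ col j := col.valid hij
    generalize col i = x at hne
    generalize col j = y at hne
    fin_cases x <;> fin_cases y <;> simp_all [sgn]
  rw [Finset.sum_eq_add_of_mem c c' (Finset.mem_univ _) (Finset.mem_univ _) hc]
  · simp [hc.symm, hs]
  · rintro k - ⟨h, h'⟩
    simp [h, h']

namespace RootedForest

variable {V : Type} {d : ℕ} (F : RootedForest V) (c : Fin d)

/-- The orthogonal representation given by matrices of indeterminates. -/
noncomputable def genericRep : V → Fin d → MvPolynomial (V × Fin d × Fin d) ℂ :=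
  F.rep c fun i k l ↦ X (i, k, l)

/-- The specialization of the generic matrices to matrices supported in the column `c`, whose
entries in that column are one indeterminate for each free coordinate. -/
noncomputable def columnMatrix (i : V) (k l : Fin d) :
    MvPolynomial (F.FreeCoord c) ℂ :=
  open Classical in
  if l = c then if h : F.parent i = none ∨ k ≠ c then X ⟨(i, k), h⟩ else 0 else 0

theorem aeval_genericRep {R : Type} [CommRing R] [Algebra ℂ R] (a : V → Fin d → Fin d → R)
    (i : V) (k : Fin d) :
    aeval (fun z : V × Fin d × Fin d ↦ a z.1 z.2.1 z.2.2) (F.genericRep c i k) =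
      F.rep c a i k := by
  have := F.map_rep c (aeval (R := ℂ) (fun z : V × Fin d × Fin d ↦ a z.1 z.2.1 z.2.2)).toRingHom
    (fun i k l ↦ X (i, k, l)) i k
  simpa [genericRep] using this

/-- An orthogonal representation `v` with nonzero coordinates `c` is itself a value of the
parametrization by matrices supported in the column `c`, so these coordinates do not vanish
identically. -/
theorem rep_columnMatrix_ne_zero {v : V → Fin d → ℂ} (hv : ∀ i, v i c ≠ 0)
    (horth : ∀ i p, F.parent i = some p → ∑ k, v i k * v p k = 0) (i : V) :
    F.rep c (F.columnMatrix c) i c ≠ 0 := by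
  let t : F.FreeCoord c → ℂ := fun x ↦
    (F.parent x.1.1).elim (v x.1.1 x.1.2) fun p ↦ v x.1.1 x.1.2 / v p c
  have h := F.map_rep c (aeval (R := ℂ) t).toRingHom (F.columnMatrix c) i c
  rw [F.rep_eq_of_orthogonal c v horth (fun _ ↦ c) hv] at h
  · intro h0
    rw [h0, map_zero] at h
    exact hv i h.symm
  · intro j hj k
    simp [columnMatrix, hj, t]
  · intro j p hp k l hkl
    by_cases hl : l = c
    · subst hl
      simp [columnMatrix, hkl, t, hp]
    · simp [columnMatrix, hl]

/-- On matrices supported in the column `c`, the free coordinates of `v_i` are the indeterminates of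
the matrix at `i`, scaled by `v_{p,c}`. -/
theorem rep_columnMatrix_child {i p : V} (hp : F.parent i = some p) {k : Fin d} (hk : k ≠ c) :
    F.rep c (F.columnMatrix c) p c * X ⟨(i, k), .inr hk⟩ = F.rep c (F.columnMatrix c) i k := by
  rw [F.rep_child c hp]
  simp [columnMatrix, hk, mul_comm]

/-- For the lower bound the generic matrices are specialized to `columnMatrix`, after which every
remaining indeterminate is a quotient of coordinates of the representation. -/
theorem trdeg_adjoin_genericRep [Finite V] {v : V → Fin d → ℂ} (hv : ∀ i, v i c ≠ 0)
    (horth : ∀ i p, F.parent i = some p → ∑ k, v i k * v p k = 0) :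
    Algebra.trdeg ℂ (Algebra.adjoin ℂ
      (Set.range fun x : V × Fin d ↦ F.genericRep c x.1 x.2)) = Nat.card (F.FreeCoord c) := by
  set s := Set.range fun x : V × Fin d ↦ F.genericRep c x.1 x.2
  let y (i : V) (k : Fin d) : Algebra.adjoin ℂ s :=
    ⟨F.genericRep c i k, Algebra.subset_adjoin ⟨(i, k), rfl⟩⟩
  let g : Algebra.adjoin ℂ s →ₐ[ℂ] MvPolynomial (F.FreeCoord c) ℂ :=
    (aeval fun z : V × Fin d × Fin d ↦ F.columnMatrix c z.1 z.2.1 z.2.2).comp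
      (Algebra.adjoin ℂ s).val
  have hg (i : V) (k : Fin d) : g (y i k) = F.rep c (F.columnMatrix c) i k :=
    F.aeval_genericRep c _ i k
  have hw := F.rep_columnMatrix_ne_zero c hv horth
  apply le_antisymm
  · refine F.trdeg_le_card_freeCoord c y (fun i p hp ↦ ?_) (fun i h ↦ ?_) ?_
    · apply Subtype.ext
      simpa [y] using! F.rep_orthogonal c (fun i k l ↦ X (R := ℂ) (i, k, l)) hp
    · exact hw i (by rw [← hg, h, map_zero])
    · have hy : (Set.range fun x : V × Fin d ↦ y x.1 x.2) = Subtype.val ⁻¹' s := by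
        ext a
        simp [y, s, Subtype.ext_iff]
      rw [hy]
      exact Algebra.adjoin_adjoin_coe_preimage
  · refine MvPolynomial.card_le_trdeg_of_mul_X_mem_range g ?_
    rintro ⟨⟨i, k⟩, h⟩
    cases hp : F.parent i with
    | none =>
      refine ⟨1, y i k, by simp, ?_⟩
      rw [hg, map_one, one_mul, F.rep_root c hp]
      simp [columnMatrix, hp]
    | some p =>
      have hk : k ≠ c := h.resolve_left (by simp [hp])
      exact ⟨y p c, y i k, hg p c ▸ hw p, by
        rw [hg, hg, ← F.rep_columnMatrix_child c hp hk]⟩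

end RootedForest

/-! ### The stratum of an induced forest -/

namespace LSS

variable {n d : ℕ} {G : SimpleGraph (Fin n)} {S : Finset (Fin n)}

theorem vanishingIdeal_zariskiClosure {σ : Type} (A : Set (σ → ℂ)) :
    vanishingIdeal ℂ (zariskiClosure A) = vanishingIdeal ℂ A :=
  zeroLocus_vanishingIdeal_galoisConnection.u_l_u_eq_u (OrderDual.toDual A)

theorem mem_strataU_iff {v : Pt n d} : v ∈ strataU d G S ↔
    (∀ i j, G.Adj i j → ∑ k, v (i, k) * v (j, k) = 0) ∧
      ∀ i, (∀ k, v (i, k) = 0) ↔ i ∈ S := by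
  simp only [strataU, orVariety, lssIdeal, zeroLocus_span, Set.mem_ofPred_eq]
  refine and_congr_left' ⟨fun h i j hij ↦ ?_, ?_⟩
  · simpa [edgePoly] using h _ ⟨i, j, hij, rfl⟩
  · rintro h _ ⟨i, j, hij, rfl⟩
    simpa [edgePoly] using h i j hij

/-- The complement of `S`, as a type of vertices. -/
abbrev Outer (S : Finset (Fin n)) : Type := ↥((S : Set (Fin n))ᶜ)

/-- Extension of a family of vectors on the complement of `S` by zero. -/
def extendZero {R : Type} [Zero R] (S : Finset (Fin n)) (v : Outer S → Fin d → R)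
    (x : Fin n × Fin d) : R :=
  if h : x.1 ∈ S then 0 else v ⟨x.1, h⟩ x.2

theorem extendZero_of_mem {R : Type} [Zero R] {v : Outer S → Fin d → R} {i : Fin n} (h : i ∈ S)
    (k : Fin d) : extendZero S v (i, k) = 0 := dif_pos h

theorem extendZero_of_notMem {R : Type} [Zero R] {v : Outer S → Fin d → R} {i : Fin n}
    (h : i ∉ S) (k : Fin d) : extendZero S v (i, k) = v ⟨i, h⟩ k := dif_neg h

theorem extendZero_mem_strataU {v : Outer S → Fin d → ℂ} (hne : ∀ i, ∃ k, v i k ≠ 0)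
    (horth : ∀ i j, (G.induce (S : Set (Fin n))ᶜ).Adj i j → ∑ k, v i k * v j k = 0) :
    extendZero S v ∈ strataU d G S := by
  refine mem_strataU_iff.2 ⟨fun i j hij ↦ ?_, fun i ↦ ⟨fun h ↦ ?_, extendZero_of_mem⟩⟩
  · by_cases hi : i ∈ S
    · simp [extendZero_of_mem hi]
    by_cases hj : j ∈ S
    · simp [extendZero_of_mem hj]
    simpa [extendZero_of_notMem hi, extendZero_of_notMem hj] using horth ⟨i, hi⟩ ⟨j, hj⟩ hij
  · by_contra hi
    obtain ⟨k, hk⟩ := hne ⟨i, hi⟩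
    exact hk (by rw [← extendZero_of_notMem (v := v) hi, h])

variable (F : RootedForest (Outer S)) (c : Fin d)

/-- The homomorphism of coordinate rings dual to the parametrization of the stratum by
matrices. -/
noncomputable def paramHom :
    Poly n d →ₐ[ℂ] MvPolynomial (Outer S × Fin d × Fin d) ℂ :=
  aeval (extendZero S (F.genericRep c))

theorem aeval_paramHom (a : Outer S → Fin d → Fin d → ℂ) (f : Poly n d) :
    aeval (fun z : Outer S × Fin d × Fin d ↦ a z.1 z.2.1 z.2.2) (paramHom F c f) =
      aeval (extendZero S (F.rep c a)) f := by
  rw [paramHom, ← AlgHom.comp_apply]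
  congr 1
  ext ⟨i, k⟩
  by_cases h : i ∈ S
  · simp [extendZero_of_mem h]
  · simpa only [AlgHom.comp_apply, aeval_X, extendZero_of_notMem h] using
      F.aeval_genericRep c a ⟨i, h⟩ k

theorem range_paramHom : (paramHom F c).range =
    Algebra.adjoin ℂ (Set.range fun x : Outer S × Fin d ↦ F.genericRep c x.1 x.2) := by
  rw [paramHom, ← Algebra.adjoin_range_eq_range_aeval]
  apply le_antisymm <;> refine Algebra.adjoin_le ?_
  · rintro _ ⟨⟨i, k⟩, rfl⟩
    by_cases h : i ∈ S
    · simp [extendZero_of_mem h]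
    · rw [extendZero_of_notMem h]
      exact Algebra.subset_adjoin ⟨(⟨i, h⟩, k), rfl⟩
  · rintro _ ⟨⟨⟨i, h⟩, k⟩, rfl⟩
    exact Algebra.subset_adjoin ⟨(i, k), extendZero_of_notMem h k⟩

/-- The parametrization is onto the stratum, and generically lands in it. -/
theorem vanishingIdeal_strataU
    (hF : ∀ i j, (G.induce (S : Set (Fin n))ᶜ).Adj i j ↔
      F.parent i = some j ∨ F.parent j = some i)
    (hgen : ∀ i, F.genericRep c i c ≠ 0) :
    vanishingIdeal ℂ (strataU d G S) = RingHom.ker (paramHom F c) := by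
  classical
  ext f
  rw [RingHom.mem_ker, mem_vanishingIdeal_iff]
  constructor
  · intro hf
    -- Off the zeros of the product below, the parametrization takes values in the stratum.
    have hprod : (∏ i, F.genericRep c i c) ≠ 0 := Finset.prod_ne_zero_iff.2 fun i _ ↦ hgen i
    refine (mul_eq_zero.1 (MvPolynomial.funext fun z ↦ ?_)).resolve_left hprod
    let a : Outer S → Fin d → Fin d → ℂ := fun i k l ↦ z (i, k, l)
    have hz (p : MvPolynomial (Outer S × Fin d × Fin d) ℂ) :
        eval z p = aeval (fun z : Outer S × Fin d × Fin d ↦ a z.1 z.2.1 z.2.2) p := by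
      rw [← coe_aeval_eq_eval]; rfl
    rw [map_mul, map_prod, map_zero]
    by_cases h : ∀ i, F.rep c a i c ≠ 0
    · rw [hz (paramHom F c f), aeval_paramHom, hf _ (extendZero_mem_strataU (G := G)
        (fun i ↦ ⟨c, h i⟩) fun i j hij ↦ ?_), mul_zero]
      rcases (hF i j).1 hij with h | h
      · exact F.rep_orthogonal c a h
      · simpa only [mul_comm] using F.rep_orthogonal c a h
    · push Not at h
      obtain ⟨i, hi⟩ := h
      rw [Finset.prod_eq_zero (Finset.mem_univ i), zero_mul]
      rw [hz, F.aeval_genericRep c a, hi]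
  · intro hf v hv
    obtain ⟨horth, hne⟩ := mem_strataU_iff.1 hv
    have hex (i : Outer S) : ∃ k, v (i.1, k) ≠ 0 := by
      by_contra! h
      exact i.2 ((hne i.1).1 h)
    choose e he using hex
    let a : Outer S → Fin d → Fin d → ℂ := fun i k l ↦
      (F.parent i).elim (v (i.1, k)) fun p ↦ if l = e p then v (i.1, k) / v (p.1, e p) else 0
    have hrep (i : Outer S) : F.rep c a i = fun k ↦ v (i.1, k) :=
      F.rep_eq_of_orthogonal c (fun i k ↦ v (i.1, k))
        (fun i p hp ↦ horth _ _ ((hF i p).2 (.inl hp))) e he a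
        (fun i hi k ↦ by simp [a, hi]) (fun i p hp k l _ ↦ by simp [a, hp]) i
    have hext : extendZero S (F.rep c a) = v := by
      funext ⟨i, k⟩
      by_cases h : i ∈ S
      · rw [extendZero_of_mem h, (hne i).2 h k]
      · rw [extendZero_of_notMem h, hrep]
    rw [← hext, ← aeval_paramHom, hf, map_zero]

end LSS

theorem theorem4p2 (n d : ℕ) (hd : 3 ≤ d) (G : SimpleGraph (Fin n)) (hG : G.IsAcyclic)
    (S : Finset (Fin n)) (hS : LSS.Admissible d G S) :
    ∃ m : ℕ, LSS.algDim (LSS.varietyV d G S) = (m : WithBot ℕ∞) ∧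
      (m : ℤ) = (d : ℤ) * ((n : ℤ) - (S.card : ℤ)) - (LSS.outerEdges G S : ℤ) := by
  classical
  have hH : (G.induce (S : Set (Fin n))ᶜ).IsAcyclic := hG.induce _
  obtain ⟨F, hF⟩ := hH.exists_rootedForest
  let c : Fin d := ⟨0, by omega⟩
  let c' : Fin d := ⟨1, by omega⟩
  obtain ⟨v, hv, hadj⟩ := hH.exists_orthogonal (c := c) (c' := c') (by simp [c, c'])
  have horth (i p) (hp : F.parent i = some p) : ∑ k, v i k * v p k = 0 :=
    hadj i p ((hF i p).2 (.inl hp))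
  have hgen (i) : F.genericRep c i c ≠ 0 := fun h ↦ by
    have := F.aeval_genericRep c (F.columnMatrix c) i c
    rw [h, map_zero] at this
    exact F.rep_columnMatrix_ne_zero c hv horth i this.symm
  refine ⟨Nat.card (F.FreeCoord c), ?_, ?_⟩
  · rw [LSS.algDim, LSS.varietyV, LSS.vanishingIdeal_zariskiClosure,
      LSS.vanishingIdeal_strataU F c hF hgen,
      ringKrullDim_eq_of_ringEquiv (Ideal.quotientKerEquivRange (LSS.paramHom F c)).toRingEquiv,
      LSS.range_paramHom]
    have : Algebra.FiniteType ℂ (Algebra.adjoin ℂ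
        (Set.range fun x : LSS.Outer S × Fin d ↦ F.genericRep c x.1 x.2)) :=
      (Subalgebra.fg_iff_finiteType _).1 (Subalgebra.fg_def.2 ⟨_, Set.finite_range _, rfl⟩)
    obtain ⟨s, hs, ht⟩ := exists_ringKrullDim_eq_and_trdeg_eq ℂ (Algebra.adjoin ℂ
      (Set.range fun x : LSS.Outer S × Fin d ↦ F.genericRep c x.1 x.2))
    rw [F.trdeg_adjoin_genericRep c hv horth] at ht
    rw [hs, Nat.cast_injective ht]
  · have h1 := F.card_freeCoord_add c
    rw [← F.ncard_edgeSet hF] at h1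
    have h2 : (Nat.card (LSS.Outer S) : ℤ) = n - S.card := by
      have h : Nat.card (LSS.Outer S) = n - S.card := by
        rw [Nat.card_coe_set_eq, Set.ncard_compl, Set.ncard_coe_finset, Nat.card_fin]
      have := S.card_le_univ
      rw [Fintype.card_fin] at this
      omega
    rw [← h2, eq_sub_iff_add_eq]
    simpa only [Nat.cast_add, Nat.cast_mul] using! congrArg (Nat.cast (R := ℤ)) h1
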